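/- Let $L\ge 1$ be an integer, let $0<\alpha<\beta$ be real numbers and $\rho=\alpha/\beta$. For $0<\theta<1$ let $L_2(g_\theta)$ be the Hilbert space of real sequences $x=(x(k))_{k\ge 0}$ with $x(0)=0$ and $\|x\|_{L_2(g_\theta)}^2=\sum_{k\ge1}x(k)^2\theta^{-k}<\infty$, with scalar product $(x,y)_{L_2(g_\theta)}=\sum_{k\ge1}x(k)y(k)\theta^{-k}$. Let $\tilde u(k)=\rho^{L^{k-1}+\cdots+L+1}$ for $k\ge0$ (so that $\tilde u(0)=1$), and let $\mathcal K$ be the bounded linear operator on $L_2(g_\theta)$ given by $\mathcal Kx(0)=0$ and $$\mathcal K x(k)=\alpha L\,\tilde u(k-1)^{L-1}x(k-1)-\bigl(\alpha L\,\tilde u(k)^{L-1}+\beta\bigr)x(k)+\beta x(k+1),\qquad k\ge1,$$ that is, $\mathcal K x(k)=\beta L\rho^{L^{k-1}}x(k-1)-\bigl(\beta L\rho^{L^k}+\beta\bigr)x(k)+\beta x(k+1)$ for $k\ge1$. Denote by $\mathrm e^{\mathcal Kt}$ the exponential series of the bounded operator $t\mathcal K$. **Theorem.** Let $0<\theta<1$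 if $L\ge2$, or $\rho\le\theta<1$ if $L=1$. 1. For every $z_0\in L_2(g_\theta)$, $z_t=\mathrm e^{\mathcal Kt}z_0$, $t\ge0$, is the unique solution in $L_2(g_\theta)$ of $\dot z_t=\mathcal Kz_t$, $t\ge0$, starting at $z_0$ (the derivative being taken in $L_2(g_\theta)$, one-sided at $t=0$). 2. There exist $\gamma_\theta>0$ and $C_\theta<\infty$ such that for all $z_0\in L_2(g_\theta)$ and all $t\ge0$ $$\|\mathrm e^{\mathcal Kt}z_0\|_{L_2(g_\theta)}\le \mathrm e^{-\gamma_\theta t}\,C_\theta\,\|z_0\|_{L_2(g_\theta)}.$$ 3. If $(L,\theta)\ne(1,\rho)$, then $\mathcal K$ is not self-adjoint in $L_2(g_\theta)$. -/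

import Mathlib

noncomputable section

namespace LinStab

/-! ### The weighted Hilbert spaces `L₂(w)` -/

/-- A sequence `w = (w(k))_{k ≥ 1}` of positive weights (the value at `0` is irrelevant). -/
structure Weight where
  toFun : ℕ → ℝ
  pos : ∀ k, 0 < toFun (k + 1)

/-- The geometric sequence `g_θ = (θ^k)_{k ≥ 1}`, for `θ > 0`. -/
def geom (θ : ℝ) (hθ : 0 < θ) : Weight where
  toFun k := θ ^ k
  pos k := pow_pos hθ (k + 1)

theorem summable_mul_div (w : Weight) {x y : ℕ → ℝ}
    (hx : Summable fun k => x (k + 1) ^ 2 / w.toFun (k + 1))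
    (hy : Summable fun k => y (k + 1) ^ 2 / w.toFun (k + 1)) :
    Summable fun k => x (k + 1) * y (k + 1) / w.toFun (k + 1) := by
  refine Summable.of_norm_bounded (hx.add hy) fun k => ?_
  have hw := w.pos k
  rw [Real.norm_eq_abs, abs_div, abs_of_pos hw, ← add_div, abs_mul]
  gcongr
  rw [← sq_abs (x (k + 1)), ← sq_abs (y (k + 1))]
  nlinarith [sq_nonneg (|x (k + 1)| - |y (k + 1)|), sq_nonneg (|x (k + 1)|),
    sq_nonneg (|y (k + 1)|)]

/-- The real sequences `x = (x(k))_{k ≥ 0}` with `x(0) = 0` and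
`∑_{k ≥ 1} x(k)² w(k)⁻¹ < ∞`, as a vector space. -/
def L2sub (w : Weight) : Submodule ℝ (ℕ → ℝ) where
  carrier := {x | x 0 = 0 ∧ Summable fun k => x (k + 1) ^ 2 / w.toFun (k + 1)}
  zero_mem' := by simp [summable_zero]
  add_mem' := by
    rintro x y ⟨hx0, hx⟩ ⟨hy0, hy⟩
    refine ⟨by simp [hx0, hy0], ?_⟩
    refine ((hx.add hy).add ((summable_mul_div w hx hy).mul_left 2)).congr fun k => ?_
    simp only [Pi.add_apply]
    ring
  smul_mem' := by
    rintro c x ⟨hx0, hx⟩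
    refine ⟨by simp [hx0], (hx.mul_left (c ^ 2)).congr fun k => ?_⟩
    simp only [Pi.smul_apply, smul_eq_mul]
    ring

/-- The space `L₂(w)`. It is a separate type, so that its topology is the one of the norm
below and not the product topology of sequences. -/
def L2 (w : Weight) : Type := ↥(L2sub w)

namespace L2

variable {w : Weight}

/-- The underlying sequence of an element of `L₂(w)`. -/
def seq (x : L2 w) : ℕ → ℝ := x.1

instance : CoeFun (L2 w) (fun _ => ℕ → ℝ) := ⟨fun x => seq x⟩

/-- A sequence in `L₂(w)` as an element of the space. -/
def mk (x : ℕ → ℝ) (hx : x ∈ L2sub w) : L2 w := ⟨x, hx⟩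

@[simp] theorem seq_mk (x : ℕ → ℝ) (hx : x ∈ L2sub w) : seq (mk x hx) = x := rfl

@[ext] theorem ext {x y : L2 w} (h : ∀ k, x k = y k) : x = y := Subtype.ext (funext h)

theorem apply_zero (x : L2 w) : x 0 = 0 := x.2.1

theorem summable (x : L2 w) : Summable fun k => x (k + 1) ^ 2 / w.toFun (k + 1) := x.2.2

section Algebra

/-- Termwise addition. -/
@[reducible] def addCommGroup : AddCommGroup (L2 w) := inferInstanceAs (AddCommGroup ↥(L2sub w))

attribute [local instance] addCommGroup

/-- Termwise scalar multiplication. -/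
@[reducible] def module : Module ℝ (L2 w) := inferInstanceAs (Module ℝ ↥(L2sub w))

attribute [local instance] module

/-- The scalar product `(x, y) = ∑_{k ≥ 1} x(k) y(k) w(k)⁻¹`. -/
instance : Inner ℝ (L2 w) := ⟨fun x y => ∑' k, x (k + 1) * y (k + 1) / w.toFun (k + 1)⟩

theorem inner_def (x y : L2 w) :
    inner ℝ x y = ∑' k, x (k + 1) * y (k + 1) / w.toFun (k + 1) := rfl

theorem inner_self (x : L2 w) :
    inner ℝ x x = ∑' k, x (k + 1) ^ 2 / w.toFun (k + 1) := by
  rw [inner_def]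
  exact tsum_congr fun k => by ring

theorem term_nonneg (w : Weight) (x : ℕ → ℝ) (k : ℕ) :
    0 ≤ x (k + 1) ^ 2 / w.toFun (k + 1) :=
  div_nonneg (sq_nonneg _) (w.pos k).le

@[reducible] def core : InnerProductSpace.Core ℝ (L2 w) where
  inner := inner ℝ
  conj_inner_symm x y := by
    simp only [inner_def, conj_trivial]
    exact tsum_congr fun k => by ring
  re_inner_nonneg x := by
    rw [inner_self]
    exact tsum_nonneg fun k => term_nonneg w _ k
  add_left x y z := by
    simp only [inner_def]
    rw [← (summable_mul_div w x.summable z.summable).tsum_add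
      (summable_mul_div w y.summable z.summable)]
    exact tsum_congr fun k => (congrArg (· / _) (add_mul _ _ _)).trans (add_div _ _ _)
  smul_left x y r := by
    simp only [inner_def, conj_trivial]
    rw [← tsum_mul_left]
    exact tsum_congr fun k => (congrArg (· / _) (mul_assoc _ _ _)).trans (mul_div_assoc _ _ _)
  definite x hx := by
    rw [inner_self] at hx
    have h := (hasSum_zero_iff_of_nonneg (fun k => term_nonneg w (seq x) k)).1
      (hx ▸ x.summable.hasSum)
    ext k
    rcases k with _ | k
    · exact x.apply_zero
    · change seq x (k + 1) = 0
      have hk := congrFun h k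
      have hw := (w.pos k).ne'
      simpa [hw] using hk

instance : NormedAddCommGroup (L2 w) := core.toNormedAddCommGroup

instance : InnerProductSpace ℝ (L2 w) := InnerProductSpace.ofCore core.toCore

end Algebra

@[simp] theorem seq_add (x y : L2 w) : seq (x + y) = seq x + seq y := rfl

@[simp] theorem seq_smul (c : ℝ) (x : L2 w) : seq (c • x) = c • seq x := rfl

theorem norm_sq (x : L2 w) : ‖x‖ ^ 2 = ∑' k, x (k + 1) ^ 2 / w.toFun (k + 1) := by
  rw [← inner_self, ← real_inner_self_eq_norm_sq]

/-- `x ↦ (x(k) w(k)^{-1/2})_{k ≥ 1}` identifies `L₂(w)` with `ℓ²`. -/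
def toEll2 (w : Weight) : L2 w ≃ₗᵢ[ℝ] lp (fun _ : ℕ => ℝ) 2 where
  toFun x := ⟨fun k => x (k + 1) / √(w.toFun (k + 1)), by
    refine memℓp_gen (x.summable.congr fun k => ?_)
    simp [div_pow, Real.sq_sqrt (w.pos k).le]⟩
  map_add' x y := by
    ext k
    exact (congrArg (· / √(w.toFun (k + 1))) (by simp)).trans (add_div _ _ _)
  map_smul' c x := by
    ext k
    simp [mul_div_assoc]
  invFun y := mk (fun k => if k = 0 then 0 else y (k - 1) * √(w.toFun k)) ⟨by simp, by
    have h := (memℓp_gen_iff (p := 2) (by simp)).1 (lp.memℓp y)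
    refine h.congr fun k => ?_
    have hw := (w.pos k).ne'
    simp [mul_pow, Real.sq_sqrt (w.pos k).le, hw]⟩
  left_inv x := by
    ext k
    rcases k with _ | k
    · simp [apply_zero]
    · have hw := (Real.sqrt_pos.2 (w.pos k)).ne'
      simp [hw]
  right_inv y := by
    ext k
    have hw := (Real.sqrt_pos.2 (w.pos k)).ne'
    simp [hw]
  norm_map' x := by
    refine (sq_eq_sq₀ (norm_nonneg _) (norm_nonneg _)).1 ?_
    rw [norm_sq]
    have h := lp.norm_rpow_eq_tsum (p := 2) (by simp)
      (show lp (fun _ : ℕ => ℝ) 2 from ⟨fun k => x (k + 1) / √(w.toFun (k + 1)), by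
        refine memℓp_gen (x.summable.congr fun k => ?_)
        simp [div_pow, Real.sq_sqrt (w.pos k).le]⟩)
    simp only [ENNReal.toReal_ofNat, Real.rpow_ofNat] at h
    refine h.trans (tsum_congr fun k => ?_)
    simp [div_pow, Real.sq_sqrt (w.pos k).le]

instance : CompleteSpace (L2 w) :=
  (toEll2 w).toIsometryEquiv.completeSpace_iff.2 inferInstance

end L2

/-! ### The stable point and the linearized operator -/

/-- The sequence `ũ(k) = ρ^{(L^k - 1)/(L - 1)} = ρ^{L^{k-1} + ⋯ + L + 1}`. -/
def uTilde (ρ : ℝ) (L : ℕ) (k : ℕ) : ℝ := ρ ^ (∑ i ∈ Finset.range k, L ^ i)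

/-- The linearization at `v` of the vector field
`F(u)(k) = α (u(k-1)^L - u(k)^L) - β (u(k) - u(k+1))`, `k ≥ 1`, acting on sequences vanishing
at `0`:
`K(v) x(k) = α L v(k-1)^{L-1} x(k-1) - (α L v(k)^{L-1} + β) x(k) + β x(k+1)`. -/
def bigK (α β : ℝ) (L : ℕ) (v x : ℕ → ℝ) : ℕ → ℝ
  | 0 => 0
  | k + 1 => α * L * v k ^ (L - 1) * x k
      - (α * L * v (k + 1) ^ (L - 1) + β) * x (k + 1) + β * x (k + 2)

/-- `𝒦 = K(ũ)`, where `ρ = α / β`. -/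
def calKseq (α β : ℝ) (L : ℕ) (x : ℕ → ℝ) : ℕ → ℝ := bigK α β L (uTilde (α / β) L) x

theorem uTilde_pow (ρ : ℝ) {L : ℕ} (hL : 1 ≤ L) (k : ℕ) :
    ρ * uTilde ρ L k ^ (L - 1) = ρ ^ L ^ k := by
  have h : (∑ i ∈ Finset.range k, L ^ i) * (L - 1) + 1 = L ^ k := by
    obtain ⟨m, rfl⟩ := Nat.exists_eq_add_of_le' hL
    exact geom_sum_mul_add m k
  rw [uTilde, ← pow_mul, ← pow_succ', h]

/-- The explicit form
`𝒦 x(k) = β L ρ^{L^{k-1}} x(k-1) - (β L ρ^{L^k} + β) x(k) + β x(k+1)`, `k ≥ 1`. -/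
theorem calKseq_succ {α β : ℝ} (hβ : β ≠ 0) {L : ℕ} (hL : 1 ≤ L) (x : ℕ → ℝ) (k : ℕ) :
    calKseq α β L x (k + 1) = β * L * (α / β) ^ L ^ k * x k
      - (β * L * (α / β) ^ L ^ (k + 1) + β) * x (k + 1) + β * x (k + 2) := by
  rw [← uTilde_pow _ hL, ← uTilde_pow _ hL, calKseq, bigK]
  field_simp

theorem bigK_add (α β : ℝ) (L : ℕ) (v x y : ℕ → ℝ) :
    bigK α β L v (x + y) = bigK α β L v x + bigK α β L v y := by
  funext k
  rcases k with _ | k <;> simp [bigK]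
  ring

theorem bigK_smul (α β : ℝ) (L : ℕ) (v : ℕ → ℝ) (c : ℝ) (x : ℕ → ℝ) :
    bigK α β L v (c • x) = c • bigK α β L v x := by
  funext k
  rcases k with _ | k <;> simp [bigK]
  ring

theorem uTilde_abs_le {ρ : ℝ} (h0 : 0 ≤ ρ) (h1 : ρ ≤ 1) (L k : ℕ) : |uTilde ρ L k| ≤ 1 := by
  rw [uTilde, abs_of_nonneg (pow_nonneg h0 _)]
  exact pow_le_one₀ h0 h1

theorem coeff_abs_le (α : ℝ) (L : ℕ) {v : ℕ → ℝ} (hv : ∀ k, |v k| ≤ 1) (k : ℕ) :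
    |α * L * v k ^ (L - 1)| ≤ |α| * L := by
  rw [abs_mul, abs_mul, abs_pow, Nat.abs_cast]
  exact mul_le_of_le_one_right (by positivity) (pow_le_one₀ (abs_nonneg _) (hv k))

/-- A bound for the operator norm of `K(v)` on `L₂(g_θ)`, squared. -/
def bigKBound (α β : ℝ) (L : ℕ) (θ : ℝ) : ℝ :=
  3 * ((|α| * L) ^ 2 / θ + (|α| * L + |β|) ^ 2 + β ^ 2 * θ)

theorem bigK_summable_and_le (α β : ℝ) (L : ℕ) {θ : ℝ} (hθ : 0 < θ) {v : ℕ → ℝ}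
    (hv : ∀ k, |v k| ≤ 1) (x : L2 (geom θ hθ)) :
    (Summable fun k => bigK α β L v x (k + 1) ^ 2 / (geom θ hθ).toFun (k + 1)) ∧
    ∑' k, bigK α β L v x (k + 1) ^ 2 / (geom θ hθ).toFun (k + 1)
      ≤ bigKBound α β L θ * ‖x‖ ^ 2 := by
  set a : ℕ → ℝ := fun k => x (k + 1) ^ 2 / θ ^ (k + 1) with ha
  have ha0 : ∀ k, 0 ≤ a k := fun k => by positivity
  have hs : Summable a := x.summable
  have hsum : ∑' k, a k = ‖x‖ ^ 2 := (L2.norm_sq x).symm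
  set b : ℕ → ℝ := fun k => x k ^ 2 / θ ^ (k + 1) with hb
  have hb0 : b 0 = 0 := by simp [hb, L2.apply_zero]
  have hb1 : ∀ k, b (k + 1) = θ⁻¹ * a k := fun k => by
    simp only [hb, ha, pow_succ θ (k + 1)]
    field_simp
  have hbH : HasSum b (θ⁻¹ * ‖x‖ ^ 2) := by
    refine (hasSum_nat_add_iff' 1).1 ?_
    simpa [hb0, hb1, hsum] using hs.hasSum.mul_left θ⁻¹
  set c : ℕ → ℝ := fun k => x (k + 2) ^ 2 / θ ^ (k + 1) with hc
  have hc1 : ∀ k, c k = θ * a (k + 1) := fun k => by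
    simp only [hc, ha, pow_succ θ (k + 1)]
    field_simp
  have hcs : Summable c :=
    (((summable_nat_add_iff 1).2 hs).mul_left θ).congr fun k => (hc1 k).symm
  have hcle : ∑' k, c k ≤ θ * ‖x‖ ^ 2 := by
    simp only [hc1]
    rw [tsum_mul_left, ← hsum, hs.tsum_eq_zero_add]
    have := ha0 0
    gcongr
    linarith
  set M := |α| * L with hM
  have hM0 : 0 ≤ M := by positivity
  have hbound : ∀ k, bigK α β L v x (k + 1) ^ 2 / θ ^ (k + 1)
      ≤ 3 * (M ^ 2 * b k + (M + |β|) ^ 2 * a k + β ^ 2 * c k) := fun k => by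
    have h1 : (α * L * v k ^ (L - 1)) ^ 2 ≤ M ^ 2 :=
      sq_le_sq' (abs_le.1 (coeff_abs_le α L hv k)).1 (abs_le.1 (coeff_abs_le α L hv k)).2
    have h2 : (α * L * v (k + 1) ^ (L - 1) + β) ^ 2 ≤ (M + |β|) ^ 2 := by
      refine sq_le_sq.2 ?_
      rw [abs_of_nonneg (a := M + |β|) (by positivity)]
      exact (abs_add_le _ _).trans (by gcongr; exact coeff_abs_le α L hv _)
    have h3 : bigK α β L v x (k + 1) ^ 2
        ≤ 3 * (M ^ 2 * x k ^ 2 + (M + |β|) ^ 2 * x (k + 1) ^ 2 + β ^ 2 * x (k + 2) ^ 2) := by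
      have e1 := mul_le_mul_of_nonneg_right h1 (sq_nonneg (x k))
      have e2 := mul_le_mul_of_nonneg_right h2 (sq_nonneg (x (k + 1)))
      rw [bigK]
      set p := α * L * v k ^ (L - 1)
      set q := α * L * v (k + 1) ^ (L - 1) + β
      nlinarith [sq_nonneg (p * x k + q * x (k + 1)), sq_nonneg (p * x k - β * x (k + 2)),
        sq_nonneg (q * x (k + 1) + β * x (k + 2))]
    calc bigK α β L v x (k + 1) ^ 2 / θ ^ (k + 1)
        ≤ 3 * (M ^ 2 * x k ^ 2 + (M + |β|) ^ 2 * x (k + 1) ^ 2 + β ^ 2 * x (k + 2) ^ 2)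
          / θ ^ (k + 1) := by gcongr
      _ = _ := by simp only [ha, hb, hc]; ring
  have hS : Summable fun k => 3 * (M ^ 2 * b k + (M + |β|) ^ 2 * a k + β ^ 2 * c k) :=
    (((hbH.summable.mul_left _).add (hs.mul_left _)).add (hcs.mul_left _)).mul_left 3
  have hK : Summable fun k => bigK α β L v x (k + 1) ^ 2 / θ ^ (k + 1) :=
    Summable.of_nonneg_of_le (fun k => by positivity) hbound hS
  refine ⟨hK, (hK.tsum_le_tsum hbound hS).trans ?_⟩
  rw [tsum_mul_left, ((hbH.summable.mul_left _).add (hs.mul_left _)).tsum_add (hcs.mul_left _),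
    (hbH.summable.mul_left _).tsum_add (hs.mul_left _), tsum_mul_left, tsum_mul_left,
    tsum_mul_left, hbH.tsum_eq, hsum, bigKBound]
  have := mul_le_mul_of_nonneg_left hcle (sq_nonneg β)
  rw [div_eq_mul_inv]
  nlinarith

/-- `K(v)`, for `|v| ≤ 1`, as a bounded operator on `L₂(g_θ)`. -/
def bigKL2 (α β : ℝ) (L : ℕ) {θ : ℝ} (hθ : 0 < θ) {v : ℕ → ℝ} (hv : ∀ k, |v k| ≤ 1) :
    L2 (geom θ hθ) →L[ℝ] L2 (geom θ hθ) :=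
  LinearMap.mkContinuous
    { toFun := fun x => L2.mk (bigK α β L v x)
        ⟨rfl, (bigK_summable_and_le α β L hθ hv x).1⟩
      map_add' := fun x y => L2.ext fun k => by
        simp only [L2.seq_mk, L2.seq_add, bigK_add]; rfl
      map_smul' := fun c x => L2.ext fun k => by
        simp only [L2.seq_mk, L2.seq_smul, bigK_smul, RingHom.id_apply]; rfl }
    √(bigKBound α β L θ) fun x => by
      refine abs_le_of_sq_le_sq' ?_ (by positivity) |>.2
      rw [mul_pow, Real.sq_sqrt (by unfold bigKBound; positivity), L2.norm_sq]
      exact (bigK_summable_and_le α β L hθ hv x).2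

/-- `𝒦 = K(ũ)` as a bounded operator on `L₂(g_θ)`, for `0 < α < β` and `θ > 0`. -/
def calK {α β : ℝ} (hα : 0 < α) (hαβ : α < β) (L : ℕ) {θ : ℝ} (hθ : 0 < θ) :
    L2 (geom θ hθ) →L[ℝ] L2 (geom θ hθ) :=
  bigKL2 α β L hθ (v := uTilde (α / β) L)
    (uTilde_abs_le (div_pos hα (hα.trans hαβ)).le ((div_le_one (hα.trans hαβ)).2 hαβ.le) L)

@[simp] theorem calK_apply {α β : ℝ} (hα : 0 < α) (hαβ : α < β) (L : ℕ) {θ : ℝ} (hθ : 0 < θ)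
    (x : L2 (geom θ hθ)) (k : ℕ) : calK hα hαβ L hθ x k = calKseq α β L x k := rfl

/-- `e^{T t}`, the exponential series of the bounded operator `t T`. -/
def expOp {w : Weight} (T : L2 w →L[ℝ] L2 w) (t : ℝ) : L2 w →L[ℝ] L2 w :=
  NormedSpace.exp (t • T)

/-- `z` solves `ż_t = T z_t` in `L₂(w)` for `t ≥ 0` (with a one-sided derivative at `0`). -/
def IsSolution {w : Weight} (T : L2 w →L[ℝ] L2 w) (z : ℝ → L2 w) : Prop :=
  ∀ t, 0 ≤ t → HasDerivWithinAt z (T (z t)) (Set.Ici 0) t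

end LinStab

end

open Filter Topology

namespace LinStab

/-! Write `𝒦 = β A`, with `A` the tridiagonal matrix with rows `(b k, -(b (k + 1) + 1), 1)` and `b k
= L ρ ^ L ^ k`. Decay is proved by a Schur test in an equivalent norm. If `h > 0` satisfies `A h ≤
-γ h` and `g > 0` satisfies `Aᵀ g ≤ -γ g`, then `A` has quadratic form at most `-γ ‖x‖²` for the
norm `∑ x(k)² g(k) / h(k)` (`sum_schur_le`). When `h / g` is comparable to `θ ^ k`, this norm is
equivalent to that of `L₂(g_θ)`, and `C_θ` is the price of the change of norm
(`IsSchurPair.exists_norm_exp_le`).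

Such pairs behave like `h ~ θ^(k/2)`, `g ~ θ^(-k/2)`. For `L = 1` these powers work exactly; for `L
≥ 2` one has `b → 0`, and they are corrected on finitely many indices or by a convergent recursion.
Uniqueness is Grönwall's for a Lipschitz field. Symmetry would force `b (k + 1) = θ` for all `k`,
hence `L = 1` and `θ = ρ`. -/

/-! ### Comparison of weighted spaces. -/

theorem Weight.sq_div_le {w w' : Weight} {C : ℝ}
    (h : ∀ k, w.toFun (k + 1) ≤ C * w'.toFun (k + 1)) (x : ℕ → ℝ) (k : ℕ) :
    x (k + 1) ^ 2 / w'.toFun (k + 1) ≤ C * (x (k + 1) ^ 2 / w.toFun (k + 1)) := by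
  rw [mul_div_assoc', div_le_div_iff₀ (w'.pos k) (w.pos k)]
  nlinarith [mul_le_mul_of_nonneg_left (h k) (sq_nonneg (x (k + 1)))]

theorem Weight.L2sub_le {w w' : Weight} {C : ℝ}
    (h : ∀ k, w.toFun (k + 1) ≤ C * w'.toFun (k + 1)) : L2sub w ≤ L2sub w' := fun x hx =>
  ⟨hx.1, Summable.of_nonneg_of_le (L2.term_nonneg w' x) (Weight.sq_div_le h x)
    (hx.2.mul_left C)⟩

/-- The inclusion `L₂(w) → L₂(w')`, when it exists, as a linear map. -/
def L2.inclusionLinear {w w' : Weight} (h : L2sub w ≤ L2sub w') : L2 w →ₗ[ℝ] L2 w' where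
  toFun x := L2.mk (seq x) (h x.2)
  map_add' x y := L2.ext fun k => by simp only [L2.seq_mk, L2.seq_add]
  map_smul' c x := L2.ext fun k => by simp only [L2.seq_mk, L2.seq_smul, RingHom.id_apply]

theorem L2.inclusionLinear_apply {w w' : Weight} (h : L2sub w ≤ L2sub w') (x : L2 w) :
    L2.inclusionLinear h x = L2.mk (seq x) (h x.2) := rfl

theorem L2.norm_inclusionLinear_le {w w' : Weight} {C : ℝ}
    (h : ∀ k, w.toFun (k + 1) ≤ C * w'.toFun (k + 1)) (x : L2 w) :
    ‖L2.inclusionLinear (Weight.L2sub_le h) x‖ ≤ √C * ‖x‖ := by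
  have hC : 0 ≤ C := (pos_of_mul_pos_left ((w.pos 0).trans_le (h 0)) (w'.pos 0).le).le
  have hs := x.summable.mul_left C
  have key := hasSum_le (Weight.sq_div_le h x)
    (hs.of_nonneg_of_le (L2.term_nonneg w' x) (Weight.sq_div_le h x)).hasSum
    (x.summable.hasSum.mul_left C)
  refine abs_le_of_sq_le_sq' ?_ (by positivity) |>.2
  rw [L2.inclusionLinear_apply, mul_pow, Real.sq_sqrt hC, L2.norm_sq, L2.norm_sq, L2.seq_mk]
  exact key

/-- The inclusion `L₂(w) → L₂(w')` when `w ≤ C w'`. -/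
noncomputable def L2.inclusion {w w' : Weight} (C : ℝ)
    (h : ∀ k, w.toFun (k + 1) ≤ C * w'.toFun (k + 1)) : L2 w →L[ℝ] L2 w' :=
  (L2.inclusionLinear (Weight.L2sub_le h)).mkContinuous √C (L2.norm_inclusionLinear_le h)

theorem L2.seq_inclusion {w w' : Weight} (C : ℝ)
    (h : ∀ k, w.toFun (k + 1) ≤ C * w'.toFun (k + 1)) (x : L2 w) :
    seq (L2.inclusion C h x) = seq x := by
  rw [L2.inclusion, LinearMap.mkContinuous_apply, L2.inclusionLinear_apply, L2.seq_mk]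

/-! ### Exponential of a bounded operator: decay and uniqueness. -/

section Semigroup

variable {E F : Type*} [NormedAddCommGroup E] [NormedSpace ℝ E] [CompleteSpace E]
  [NormedAddCommGroup F] [InnerProductSpace ℝ F]

theorem hasDerivAt_exp_smul_apply (T : E →L[ℝ] E) (x : E) (t : ℝ) :
    HasDerivAt (fun s : ℝ => NormedSpace.exp (s • T) x) (T (NormedSpace.exp (t • T) x)) t := by
  have h := hasDerivAt_exp_smul_const' (𝕂 := ℝ) T t
  simpa using h.clm_apply (hasDerivAt_const t x)

/-- Dissipativity is measured through `J`, so the norm can be changed while the operator and its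
exponential stay on `E`. The function `exp (2γs) ‖J (exp (sT) x)‖²` has nonpositive derivative. -/
theorem norm_map_exp_le_of_inner_le (T : E →L[ℝ] E) (J : E →L[ℝ] F) {γ : ℝ}
    (h : ∀ x, inner ℝ (J x) (J (T x)) ≤ -γ * ‖J x‖ ^ 2) (x : E) {t : ℝ} (ht : 0 ≤ t) :
    ‖J (NormedSpace.exp (t • T) x)‖ ≤ Real.exp (-γ * t) * ‖J x‖ := by
  set f : ℝ → ℝ := fun s =>
    Real.exp (2 * γ * s) * ‖J (NormedSpace.exp (s • T) x)‖ ^ 2 with hf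
  have hd : ∀ s, HasDerivAt f
      (Real.exp (2 * γ * s) * (2 * γ) * ‖J (NormedSpace.exp (s • T) x)‖ ^ 2 +
        Real.exp (2 * γ * s) * (2 * inner ℝ (J (NormedSpace.exp (s • T) x))
          (J (T (NormedSpace.exp (s • T) x))))) s := fun s => by
    have h1 : HasDerivAt (fun s : ℝ => Real.exp (2 * γ * s))
        (Real.exp (2 * γ * s) * (2 * γ)) s := by
      simpa using ((hasDerivAt_id s).const_mul (2 * γ)).exp
    exact h1.mul ((J.hasFDerivAt.comp_hasDerivAt s (hasDerivAt_exp_smul_apply T x s)).norm_sq)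
  have hanti : Antitone f := antitone_of_hasDerivAt_nonpos hd fun s => by
    have := mul_le_mul_of_nonneg_left (h (NormedSpace.exp (s • T) x))
      (Real.exp_pos (2 * γ * s)).le
    simp only [Pi.zero_apply]
    linarith
  have h0 : Real.exp (2 * γ * t) * ‖J (NormedSpace.exp (t • T) x)‖ ^ 2 ≤ ‖J x‖ ^ 2 := by
    simpa [hf] using hanti ht
  refine abs_le_of_sq_le_sq' ?_ (by positivity) |>.2
  have hexp : Real.exp (-γ * t) ^ 2 * Real.exp (2 * γ * t) = 1 := by
    rw [← Real.exp_nat_mul, ← Real.exp_add]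
    simp
    ring
  calc ‖J (NormedSpace.exp (t • T) x)‖ ^ 2
      = Real.exp (-γ * t) ^ 2 * (Real.exp (2 * γ * t) *
          ‖J (NormedSpace.exp (t • T) x)‖ ^ 2) := by rw [← mul_assoc, hexp, one_mul]
    _ ≤ Real.exp (-γ * t) ^ 2 * ‖J x‖ ^ 2 := by gcongr
    _ = _ := by ring

theorem eq_exp_smul_apply_of_hasDerivWithinAt {T : E →L[ℝ] E} {z : ℝ → E}
    (hz : ∀ t, 0 ≤ t → HasDerivWithinAt z (T (z t)) (Set.Ici 0) t) {t : ℝ} (ht : 0 ≤ t) :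
    z t = NormedSpace.exp (t • T) (z 0) := by
  refine ODE_solution_unique (v := fun _ => T) (K := ‖T‖₊) (a := 0) (b := t)
    (fun _ => T.lipschitz) (fun s hs => ((hz s hs.1).continuousWithinAt.mono fun _ hu => hu.1))
    (fun s hs => (hz s hs.1).mono (Set.Ici_subset_Ici.2 hs.1))
    (fun s _ => (hasDerivAt_exp_smul_apply T (z 0) s).continuousAt.continuousWithinAt)
    (fun s _ => (hasDerivAt_exp_smul_apply T (z 0) s).hasDerivWithinAt) ?_
    (Set.right_mem_Icc.2 ht)
  simp

end Semigroup

/-! ### The Schur test and the decay it gives. -/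

/-- The Schur test, with the supersolutions `h` of the matrix with rows
`(b k, -(b (k + 1) + 1), 1)` and `g` of its transpose. -/
theorem sum_schur_le {b g h x : ℕ → ℝ} {γ : ℝ} (hb : ∀ k, 0 ≤ b k)
    (hg0 : g 0 = 0) (hg : ∀ k, 0 < g (k + 1)) (hh0 : h 0 = 0) (hh : ∀ k, 0 < h (k + 1))
    (hsupg : ∀ k, b (k + 1) * g (k + 2) - (b (k + 1) + 1) * g (k + 1) + g k ≤ -γ * g (k + 1))
    (hsuph : ∀ k, b k * h k - (b (k + 1) + 1) * h (k + 1) + h (k + 2) ≤ -γ * h (k + 1))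
    (hx : x 0 = 0) (n : ℕ) :
    ∑ k ∈ Finset.range n, x (k + 1) * (b k * x k - (b (k + 1) + 1) * x (k + 1) + x (k + 2)) *
        (g (k + 1) / h (k + 1)) ≤
      -γ * ∑ k ∈ Finset.range n, x (k + 1) ^ 2 * (g (k + 1) / h (k + 1)) +
        g n / h (n + 1) * x (n + 1) ^ 2 / 2 := by
  obtain ⟨f, hf⟩ : ∃ f : ℕ → ℝ, ∀ k, x k = h k * f k := by
    -- At `k = 0` both `x` and `h` vanish, so the value of the quotient there is harmless.
    refine ⟨fun k => x k / h k, fun k => ?_⟩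
    rcases k with _ | k
    · simp [hx]
    · have := (hh k).ne'
      field_simp
  have hgn : ∀ k, 0 ≤ g k := fun k => by
    rcases k with _ | k
    · exact hg0.ge
    · exact (hg k).le
  have hhn : ∀ k, 0 ≤ h k := fun k => by
    rcases k with _ | k
    · exact hh0.ge
    · exact (hh k).le
  -- With `x = h f`, each product `f k * f (k + 1)` is at most half the sum of the squares. The
  -- diagonal terms are absorbed by half of each supersolution inequality, and what is left over
  -- telescopes.
  have key : ∀ k, x (k + 1) * (b k * x k - (b (k + 1) + 1) * x (k + 1) + x (k + 2)) *
        (g (k + 1) / h (k + 1)) ≤ -γ * (x (k + 1) ^ 2 * (g (k + 1) / h (k + 1))) +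
      ((g (k + 1) * h (k + 2) * f (k + 2) ^ 2 / 2
          - b (k + 1) * g (k + 2) * h (k + 1) * f (k + 1) ^ 2 / 2)
        - (g k * h (k + 1) * f (k + 1) ^ 2 / 2
          - b k * g (k + 1) * h k * f k ^ 2 / 2)) := fun k => by
    have e1 : x (k + 1) * (b k * x k - (b (k + 1) + 1) * x (k + 1) + x (k + 2)) *
        (g (k + 1) / h (k + 1)) = g (k + 1) * f (k + 1) *
          (b k * (h k * f k) - (b (k + 1) + 1) * (h (k + 1) * f (k + 1)) +
            h (k + 2) * f (k + 2)) := by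
      have := (hh k).ne'
      rw [hf, hf, hf]
      field_simp
    have e2 : x (k + 1) ^ 2 * (g (k + 1) / h (k + 1)) = g (k + 1) * h (k + 1) * f (k + 1) ^ 2 := by
      have := (hh k).ne'
      rw [hf]
      field_simp
    rw [e1, e2]
    have i1 := mul_le_mul_of_nonneg_right (hsupg k)
      (mul_nonneg (hhn (k + 1)) (sq_nonneg (f (k + 1))))
    have i2 := mul_le_mul_of_nonneg_right (hsuph k)
      (mul_nonneg (hgn (k + 1)) (sq_nonneg (f (k + 1))))
    have i3 := mul_nonneg (mul_nonneg (mul_nonneg (hgn (k + 1)) (hb k)) (hhn k))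
      (sq_nonneg (f k - f (k + 1)))
    have i4 := mul_nonneg (mul_nonneg (hgn (k + 1)) (hhn (k + 2)))
      (sq_nonneg (f (k + 1) - f (k + 2)))
    linarith
  refine (Finset.sum_le_sum fun k _ => key k).trans ?_
  rw [Finset.sum_add_distrib, ← Finset.mul_sum,
    Finset.sum_range_sub (fun k => g k * h (k + 1) * f (k + 1) ^ 2 / 2
      - b k * g (k + 1) * h k * f k ^ 2 / 2) n]
  have e3 : g n / h (n + 1) * x (n + 1) ^ 2 = g n * h (n + 1) * f (n + 1) ^ 2 := by
    have := (hh n).ne'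
    rw [hf]
    field_simp
  -- Of the two boundary terms at `n`, this one has a favourable sign and is dropped.
  have i5 : 0 ≤ b n * g (n + 1) * h n * f n ^ 2 :=
    mul_nonneg (mul_nonneg (mul_nonneg (hb n) (hgn _)) (hhn n)) (sq_nonneg _)
  rw [e3]
  simp only [hg0, hh0]
  linarith

/-- A pair of supersolutions `h` of the matrix with rows `(b k, -(b (k + 1) + 1), 1)` and `g` of
its transpose, with decay rate `γ`, such that `h / g` is comparable to `θ ^ k`. -/
structure IsSchurPair (b : ℕ → ℝ) (θ γ : ℝ) (g h : ℕ → ℝ) : Prop where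
  g_zero : g 0 = 0
  h_zero : h 0 = 0
  g_pos : ∀ k, 0 < g (k + 1)
  h_pos : ∀ k, 0 < h (k + 1)
  g_mono : Monotone g
  g_super : ∀ k, b (k + 1) * g (k + 2) - (b (k + 1) + 1) * g (k + 1) + g k ≤ -γ * g (k + 1)
  h_super : ∀ k, b k * h k - (b (k + 1) + 1) * h (k + 1) + h (k + 2) ≤ -γ * h (k + 1)
  exists_le : ∃ C, ∀ k, θ ^ (k + 1) ≤ C * (h (k + 1) / g (k + 1))
  exists_ge : ∃ C, ∀ k, h (k + 1) / g (k + 1) ≤ C * θ ^ (k + 1)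

/-- The two comparisons of `h / g` with `θ ^ k` give mutually inverse bounded inclusions `J`, `J'`
between `L₂(g_θ)` and `L₂(h / g)`; the decay proved in the latter is carried back. -/
theorem IsSchurPair.exists_norm_exp_le {b : ℕ → ℝ} {θ γ : ℝ} {g h : ℕ → ℝ}
    (hp : IsSchurPair b θ γ g h) (hθ : 0 < θ) (hb : ∀ k, 0 ≤ b k) {β : ℝ} (hβ : 0 < β)
    {T : L2 (geom θ hθ) →L[ℝ] L2 (geom θ hθ)}
    (hT : ∀ x k, T x (k + 1) = β * (b k * x k - (b (k + 1) + 1) * x (k + 1) + x (k + 2))) :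
    ∃ C : ℝ, ∀ (x : L2 (geom θ hθ)) (t : ℝ), 0 ≤ t →
      ‖NormedSpace.exp (t • T) x‖ ≤ Real.exp (-(β * γ) * t) * C * ‖x‖ := by
  obtain ⟨C₁, hC₁⟩ := hp.exists_le
  obtain ⟨C₂, hC₂⟩ := hp.exists_ge
  let v : Weight := ⟨fun k => h k / g k, fun k => div_pos (hp.h_pos k) (hp.g_pos k)⟩
  let J : L2 (geom θ hθ) →L[ℝ] L2 v := L2.inclusion C₁ hC₁
  let J' : L2 v →L[ℝ] L2 (geom θ hθ) := L2.inclusion C₂ hC₂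
  have hseq : ∀ x, L2.seq (J x) = L2.seq x := L2.seq_inclusion C₁ hC₁
  have hseq' : ∀ y, L2.seq (J' y) = L2.seq y := L2.seq_inclusion C₂ hC₂
  have hJ : ∀ x, J' (J x) = x := fun x => L2.ext fun k => by
    rw [hseq', hseq]
  have hdiss : ∀ x, inner ℝ (J x) (J (T x)) ≤ -(β * γ) * ‖J x‖ ^ 2 := fun x => by
    have hs1 := summable_mul_div v (J x).summable (J (T x)).summable
    have hs2 := (J x).summable
    rw [hseq, hseq] at hs1
    rw [hseq] at hs2
    have e1 : inner ℝ (J x) (J (T x)) =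
        ∑' k, x (k + 1) * T x (k + 1) / v.toFun (k + 1) := by
      rw [L2.inner_def, hseq, hseq]
    have en : ‖J x‖ ^ 2 = ∑' k, x (k + 1) ^ 2 / v.toFun (k + 1) := by rw [L2.norm_sq, hseq]
    -- Monotonicity of `g` bounds the boundary term of the Schur test by a term of the convergent
    -- series of `‖J x‖²`, so it disappears in the limit.
    have hlast : Tendsto (fun n => β * (x (n + 1) ^ 2 / v.toFun (n + 1) / 2)) atTop (𝓝 0) := by
      have := (hs2.tendsto_atTop_zero.div_const 2).const_mul β
      rwa [zero_div, mul_zero] at this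
    have hlim := (hs2.hasSum.tendsto_sum_nat.const_mul (-(β * γ))).add hlast
    rw [add_zero, ← en] at hlim
    rw [e1]
    refine le_of_tendsto_of_tendsto' hs1.hasSum.tendsto_sum_nat hlim fun n => ?_
    have hn := mul_le_mul_of_nonneg_left (sum_schur_le hb hp.g_zero hp.g_pos hp.h_zero hp.h_pos
      hp.g_super hp.h_super x.apply_zero n) hβ.le
    have hgn : g n / h (n + 1) * x (n + 1) ^ 2 / 2 ≤ x (n + 1) ^ 2 / v.toFun (n + 1) / 2 := by
      have e : x (n + 1) ^ 2 / v.toFun (n + 1) = g (n + 1) / h (n + 1) * x (n + 1) ^ 2 := by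
        change x (n + 1) ^ 2 / (h (n + 1) / g (n + 1)) = _
        rw [div_div_eq_mul_div]
        ring
      rw [e]
      have := (hp.h_pos n).le
      have := hp.g_mono n.le_succ
      gcongr
    have e2 : ∀ k, x (k + 1) * T x (k + 1) / v.toFun (k + 1) =
        β * (x (k + 1) * (b k * x k - (b (k + 1) + 1) * x (k + 1) + x (k + 2)) *
        (g (k + 1) / h (k + 1))) := fun k => by
      change x (k + 1) * T x (k + 1) / (h (k + 1) / g (k + 1)) = _
      rw [hT, div_div_eq_mul_div]
      ring
    have e3 : ∀ k, x (k + 1) ^ 2 / v.toFun (k + 1) =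
        x (k + 1) ^ 2 * (g (k + 1) / h (k + 1)) := fun k => by
      change x (k + 1) ^ 2 / (h (k + 1) / g (k + 1)) = _
      rw [div_div_eq_mul_div]
      ring
    simp only [e2, e3, ← Finset.mul_sum]
    have := mul_le_mul_of_nonneg_left hgn hβ.le
    rw [e3] at this
    linarith
  refine ⟨‖J'‖ * ‖J‖, fun x t ht => ?_⟩
  calc ‖NormedSpace.exp (t • T) x‖ = ‖J' (J (NormedSpace.exp (t • T) x))‖ := by rw [hJ]
    _ ≤ ‖J'‖ * ‖J (NormedSpace.exp (t • T) x)‖ := J'.le_opNorm _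
    _ ≤ ‖J'‖ * (Real.exp (-(β * γ) * t) * (‖J‖ * ‖x‖)) := by
        gcongr
        exact (norm_map_exp_le_of_inner_le T J hdiss x ht).trans (by gcongr; exact J.le_opNorm x)
    _ = _ := by ring

/-! ### Construction of Schur pairs. -/

theorem exists_pos_le_prod {m : ℕ → ℝ} (hm : ∀ k, 0 < m k) (hm1 : ∀ k, m k ≤ 1)
    (hev : ∀ᶠ k in atTop, m k = 1) : ∃ c > 0, ∀ n, c ≤ ∏ k ∈ Finset.range n, m k := by
  obtain ⟨N, hN⟩ := eventually_atTop.1 hev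
  have hpos : ∀ n, 0 < ∏ k ∈ Finset.range n, m k := fun n => Finset.prod_pos fun k _ => hm k
  have hanti : Antitone fun n => ∏ k ∈ Finset.range n, m k := antitone_nat_of_succ_le fun n => by
    rw [Finset.prod_range_succ]
    exact mul_le_of_le_one_right (hpos n).le (hm1 n)
  refine ⟨_, hpos N, fun n => ?_⟩
  have h1 : ∏ k ∈ Finset.range (N + n), m k = ∏ k ∈ Finset.range N, m k := by
    rw [← Finset.prod_range_mul_prod_Ico m (Nat.le_add_right N n),
      Finset.prod_eq_one (s := Finset.Ico N (N + n)) fun k hk => hN k (Finset.mem_Ico.1 hk).1,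
      mul_one]
  exact h1.symm.le.trans (hanti (Nat.le_add_left n N))

/-- Once `c k ≤ 1 / 2`, any bound `C ≥ 2` propagates, since `C / 2 + 1 ≤ C`; the finitely many
earlier values are bounded by their sum. -/
theorem exists_forall_le_of_le_mul_add_one {u c : ℕ → ℝ} (hu : ∀ k, 0 ≤ u k)
    (hc : Tendsto c atTop (𝓝 0)) (h : ∀ k, u (k + 1) ≤ c k * u k + 1) :
    ∃ C > 0, ∀ k, u k ≤ C := by
  obtain ⟨N, hN⟩ := eventually_atTop.1 (hc.eventually_le_const (show (0 : ℝ) < 1 / 2 by norm_num))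
  have hsum : 0 ≤ ∑ i ∈ Finset.range (N + 1), u i := Finset.sum_nonneg fun i _ => hu i
  refine ⟨∑ i ∈ Finset.range (N + 1), u i + 2, by linarith, fun k => ?_⟩
  have hsmall : ∀ k ≤ N, u k ≤ ∑ i ∈ Finset.range (N + 1), u i + 2 := fun k hk => by
    have := Finset.single_le_sum (f := u) (fun i _ => hu i)
      (Finset.mem_range.2 (Nat.lt_succ_of_le hk))
    linarith
  induction k with
  | zero => exact hsmall 0 N.zero_le
  | succ k ih =>
    rcases Nat.lt_or_ge N (k + 1) with hk | hk
    · have := mul_le_mul_of_nonneg_right (hN k (Nat.le_of_lt_succ hk)) (hu k)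
      linarith [h k]
    · exact hsmall _ hk

/-- A supersolution of the transposed matrix which grows like `κ ^ k`. -/
theorem exists_transpose_supersolution {b : ℕ → ℝ} (hb : ∀ k, 0 < b k)
    (hlim : Tendsto b atTop (𝓝 0)) {κ : ℝ} (hκ : 1 < κ) :
    ∃ g : ℕ → ℝ, g 0 = 0 ∧ Monotone g ∧
      (∃ γ > 0, ∀ k, b (k + 1) * g (k + 2) - (b (k + 1) + 1) * g (k + 1) + g k
        ≤ -γ * g (k + 1)) ∧
      (∃ c > 0, ∀ k, c * κ ^ k ≤ g (k + 1)) ∧ ∃ C > 0, ∀ k, g (k + 1) ≤ C * κ ^ k := by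
  have hκ0 : 0 < κ := one_pos.trans hκ
  -- `g` will have increments `d k = κ ^ k * e k`, with `e` the partial products of `m`. The left
  -- side of the supersolution inequality is `b (k + 1) * d (k + 1) - d k`, and this `m` makes it at
  -- most `-d k / 2`. As `b → 0`, `m` is eventually `1`, so `d` stays comparable to `κ ^ k`.
  let m : ℕ → ℝ := fun i => min 1 (1 / (2 * κ * b (i + 1)))
  have hm : ∀ k, 0 < m k := fun k => lt_min one_pos (by have := hb (k + 1); positivity)
  have hev : ∀ᶠ k in atTop, m k = 1 := by
    have h1 : Tendsto (fun k => 2 * κ * b (k + 1)) atTop (𝓝 0) := by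
      simpa using ((tendsto_add_atTop_iff_nat 1).2 hlim).const_mul (2 * κ)
    filter_upwards [h1.eventually_le_const one_pos] with k hk
    exact min_eq_left ((one_le_div (by have := hb (k + 1); positivity)).2 hk)
  obtain ⟨c, hc, hce⟩ := exists_pos_le_prod hm (fun k => min_le_left _ _) hev
  set e : ℕ → ℝ := fun n => ∏ k ∈ Finset.range n, m k with he
  have he1 : ∀ n, e n ≤ 1 := fun n =>
    Finset.prod_le_one (fun k _ => (hm k).le) fun k _ => min_le_left _ _
  have hepos : ∀ n, 0 < e n := fun n => hc.trans_le (hce n)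
  set g : ℕ → ℝ := fun n => ∑ k ∈ Finset.range n, κ ^ k * e k with hg
  have hgs : ∀ n, g (n + 1) = g n + κ ^ n * e n := fun n => Finset.sum_range_succ _ _
  have hdpos : ∀ n, 0 < κ ^ n * e n := fun n => mul_pos (pow_pos hκ0 n) (hepos n)
  have hgn : ∀ n, 0 ≤ g n := fun n => Finset.sum_nonneg fun k _ => (hdpos k).le
  have hup : ∀ k, g (k + 1) ≤ κ / (κ - 1) * κ ^ k := fun k => by
    calc g (k + 1) ≤ ∑ i ∈ Finset.range (k + 1), κ ^ i :=
          Finset.sum_le_sum fun i _ => mul_le_of_le_one_right (pow_pos hκ0 i).le (he1 i)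
      _ = (κ ^ (k + 1) - 1) / (κ - 1) := geom_sum_eq hκ.ne' _
      _ ≤ κ ^ (k + 1) / (κ - 1) := by
          have := sub_pos.2 hκ
          gcongr
          linarith
      _ = _ := by ring
  have hK : 0 < κ / (κ - 1) := div_pos hκ0 (sub_pos.2 hκ)
  refine ⟨g, by simp [hg], monotone_nat_of_le_succ fun n => by linarith [hgs n, hdpos n],
    ⟨c / (2 * (κ / (κ - 1))), by positivity, fun k => ?_⟩, ⟨c, hc, fun k => ?_⟩,
    ⟨_, hK, hup⟩⟩
  · have h1 : b (k + 1) * (κ ^ (k + 1) * e (k + 1)) ≤ κ ^ k * e k / 2 := by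
      have h2 : m k * (2 * κ * b (k + 1)) ≤ 1 := by
        have hpos : 0 < 2 * κ * b (k + 1) := by have := hb (k + 1); positivity
        exact (le_div_iff₀ hpos).1 (min_le_right _ _)
      have h3 : e (k + 1) = e k * m k := Finset.prod_range_succ _ _
      rw [h3, pow_succ]
      have := mul_le_mul_of_nonneg_left h2 (hdpos k).le
      linarith
    have h4 : c / (2 * (κ / (κ - 1))) * g (k + 1) ≤ κ ^ k * e k / 2 := by
      calc c / (2 * (κ / (κ - 1))) * g (k + 1)
          ≤ c / (2 * (κ / (κ - 1))) * (κ / (κ - 1) * κ ^ k) := by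
            gcongr
            exact hup k
        _ = κ ^ k * c / 2 := by
            have := (sub_pos.2 hκ).ne'
            field_simp
        _ ≤ κ ^ k * e k / 2 := by
            gcongr
            exact hce k
    rw [hgs (k + 1)]
    linarith [hgs k]
  · have := mul_le_mul_of_nonneg_left (hce k) (pow_pos hκ0 k).le
    linarith [hgs k, hgn k]

/-- A supersolution of the matrix which decays like `r ^ k`. -/
theorem exists_supersolution {b : ℕ → ℝ} (hb : ∀ k, 0 ≤ b k)
    (hlim : Tendsto b atTop (𝓝 0)) {r : ℝ} (hr : 0 < r) (hr1 : r < 1) :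
    ∃ h : ℕ → ℝ, h 0 = 0 ∧
      (∃ γ > 0, ∀ k, b k * h k - (b (k + 1) + 1) * h (k + 1) + h (k + 2) ≤ -γ * h (k + 1)) ∧
      (∀ k, r ^ k ≤ h (k + 1)) ∧ ∃ C > 0, ∀ k, h (k + 1) ≤ C * r ^ k := by
  -- By this recursion the left side of the supersolution inequality is exactly `r ^ (k + 1) - r ^
  -- k`, that is `-(1 - r) * r ^ k`.
  let h : ℕ → ℝ := Nat.rec 0 fun k y => b k * y + r ^ k
  have hs : ∀ k, h (k + 1) = b k * h k + r ^ k := fun k => rfl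
  have hn : ∀ k, 0 ≤ h k := fun k => by
    induction k with
    | zero => exact le_rfl
    | succ k ih => rw [hs]; have := hb k; positivity
  -- The rescaled sequence obeys `u (k + 1) = (b (k + 1) / r) * u k + 1`.
  obtain ⟨C, hC, hCu⟩ := exists_forall_le_of_le_mul_add_one (u := fun k => h (k + 1) / r ^ k)
    (c := fun k => b (k + 1) / r) (fun k => div_nonneg (hn (k + 1)) (pow_pos hr k).le)
    (by simpa using ((tendsto_add_atTop_iff_nat 1).2 hlim).div_const r)
    (fun k => by
      rw [hs (k + 1), pow_succ]
      apply le_of_eq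
      field_simp)
  have hup : ∀ k, h (k + 1) ≤ C * r ^ k := fun k => (div_le_iff₀ (pow_pos hr k)).1 (hCu k)
  refine ⟨h, rfl, ⟨(1 - r) / C, div_pos (sub_pos.2 hr1) hC, fun k => ?_⟩, fun k => ?_,
    C, hC, hup⟩
  · have h1 : (1 - r) / C * h (k + 1) ≤ (1 - r) * r ^ k := by
      have := sub_pos.2 hr1
      calc (1 - r) / C * h (k + 1) ≤ (1 - r) / C * (C * r ^ k) := by
            gcongr
            exact hup k
        _ = _ := by field_simp
    have h2 := hs (k + 1)
    rw [pow_succ] at h2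
    linarith [hs k]
  · have := mul_nonneg (hb k) (hn k)
    linarith [hs k]

theorem exists_isSchurPair_of_tendsto_zero {b : ℕ → ℝ} (hb : ∀ k, 0 < b k)
    (hlim : Tendsto b atTop (𝓝 0)) {θ : ℝ} (hθ0 : 0 < θ) (hθ1 : θ < 1) :
    ∃ γ > 0, ∃ g h, IsSchurPair b θ γ g h := by
  have hr0 : 0 < √θ := Real.sqrt_pos.2 hθ0
  have hr1 : √θ < 1 := by rwa [Real.sqrt_lt' one_pos, one_pow]
  -- Growth `θ^(-k/2)` for `g` and decay `θ^(k/2)` for `h` make `h / g` comparable to `θ ^ k`.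
  obtain ⟨g, hg0, hgm, ⟨γ₁, hγ₁, hg⟩, ⟨c, hc, hgl⟩, D, hD, hgu⟩ :=
    exists_transpose_supersolution hb hlim (κ := (√θ)⁻¹) ((one_lt_inv₀ hr0).2 hr1)
  obtain ⟨h, hh0, ⟨γ₂, hγ₂, hh⟩, hhl, C, hC, hhu⟩ :=
    exists_supersolution (fun k => (hb k).le) hlim hr0 hr1
  have hgp : ∀ k, 0 < g (k + 1) := fun k => lt_of_lt_of_le (by positivity) (hgl k)
  have hhp : ∀ k, 0 < h (k + 1) := fun k => lt_of_lt_of_le (by positivity) (hhl k)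
  have hsq : ∀ k, √θ ^ k * √θ ^ k = θ ^ k := fun k => by
    rw [← mul_pow, Real.mul_self_sqrt hθ0.le]
  refine ⟨min γ₁ γ₂, lt_min hγ₁ hγ₂, g, h, hg0, hh0, hgp, hhp, hgm, fun k => ?_, fun k => ?_,
    ⟨D * θ, fun k => ?_⟩, C / c / θ, fun k => ?_⟩
  · have := mul_le_mul_of_nonneg_right (min_le_left γ₁ γ₂) (hgp k).le
    linarith [hg k]
  · have := mul_le_mul_of_nonneg_right (min_le_right γ₁ γ₂) (hhp k).le
    linarith [hh k]
  · rw [← mul_div_assoc, le_div_iff₀ (hgp k)]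
    have h1 := hgu k
    rw [inv_pow, ← div_eq_mul_inv, le_div_iff₀ (pow_pos hr0 k)] at h1
    calc θ ^ (k + 1) * g (k + 1) = θ * √θ ^ k * (g (k + 1) * √θ ^ k) := by
          rw [pow_succ, ← hsq]
          ring
      _ ≤ θ * √θ ^ k * D := by gcongr
      _ ≤ θ * h (k + 1) * D := by
          gcongr
          exact hhl k
      _ = _ := by ring
  · rw [div_le_iff₀ (hgp k)]
    have h1 := hgl k
    rw [inv_pow, ← div_eq_mul_inv, div_le_iff₀ (pow_pos hr0 k)] at h1
    calc h (k + 1) ≤ C * √θ ^ k := hhu k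
      _ = C / c * √θ ^ k * c := by field_simp
      _ ≤ C / c * √θ ^ k * (g (k + 1) * √θ ^ k) := by gcongr
      _ = C / c * (√θ ^ k * √θ ^ k) * g (k + 1) := by ring
      _ = _ := by
          rw [hsq, pow_succ]
          field_simp

/-- With `r = √θ`, the sequences `r ^ k` and `r ^ (-k)` are exact eigensequences away from the
boundary, since `ρ - (ρ + 1) r + r² = -(r - ρ)(1 - r)`. Replacing their value at `0` by `0` only
lowers the left sides. -/
theorem exists_isSchurPair_of_const {ρ θ : ℝ} (hρ : 0 ≤ ρ) (hθ0 : 0 < θ) (hθ1 : θ < 1)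
    (hρθ : ρ ≤ θ) : ∃ γ > 0, ∃ g h, IsSchurPair (fun _ => ρ) θ γ g h := by
  have hr0 : 0 < √θ := Real.sqrt_pos.2 hθ0
  have hr1 : √θ < 1 := by rwa [Real.sqrt_lt' one_pos, one_pow]
  have hsq : √θ * √θ = θ := Real.mul_self_sqrt hθ0.le
  set r := √θ
  have hγ : 0 < (r - ρ) * (1 - r) / r := by
    -- `ρ ≤ θ = r² < r`: this is where the lower bound on `θ` enters.
    have : ρ < r := by nlinarith
    have := sub_pos.2 this
    have := sub_pos.2 hr1
    positivity
  have hrw : ∀ k : ℕ, 0 < r ^ k := fun k => pow_pos hr0 k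
  refine ⟨(r - ρ) * (1 - r) / r, hγ, fun k => if k = 0 then 0 else (r ^ k)⁻¹,
    fun k => if k = 0 then 0 else r ^ k, by simp, by simp, fun k => by simpa using hrw (k + 1),
    fun k => by simpa using hrw (k + 1), monotone_nat_of_le_succ fun k => ?_, fun k => ?_,
    fun k => ?_, ⟨1, fun k => ?_⟩, 1, fun k => ?_⟩
  · rcases k with _ | k
    · simpa using hr0.le
    · simp only [Nat.add_eq_zero_iff, one_ne_zero, and_false, if_false]
      exact inv_anti₀ (hrw _) (pow_le_pow_of_le_one hr0.le hr1.le (Nat.le_succ _))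
  · have h1 : (if k = 0 then 0 else (r ^ k)⁻¹) ≤ (r ^ k)⁻¹ := by
      split_ifs
      · exact (inv_pos.2 (hrw k)).le
      · exact le_rfl
    have h2 : ρ * (r ^ (k + 2))⁻¹ - (ρ + 1) * (r ^ (k + 1))⁻¹ + (r ^ k)⁻¹ =
        -((r - ρ) * (1 - r) / r) * (r ^ (k + 1))⁻¹ := by
      have := hrw k
      rw [pow_succ, pow_succ]
      field_simp
      ring
    simp only [Nat.add_eq_zero_iff, one_ne_zero, OfNat.ofNat_ne_zero, and_false, if_false]
    linarith
  · have h1 : (if k = 0 then 0 else r ^ k) ≤ r ^ k := by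
      split_ifs
      · exact (hrw k).le
      · exact le_rfl
    have h2 : ρ * r ^ k - (ρ + 1) * r ^ (k + 1) + r ^ (k + 2) =
        -((r - ρ) * (1 - r) / r) * r ^ (k + 1) := by
      rw [pow_succ, pow_succ]
      field_simp
      ring
    simp only [Nat.add_eq_zero_iff, one_ne_zero, OfNat.ofNat_ne_zero, and_false, if_false]
    have := mul_le_mul_of_nonneg_left h1 hρ
    linarith
  all_goals
    simp only [Nat.add_eq_zero_iff, one_ne_zero, and_false, if_false, div_inv_eq_mul, one_mul]
    rw [← mul_pow, hsq]

/-! ### Failure of self-adjointness. -/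

/-- The unit sequence `e_{k+1}`. -/
noncomputable def L2.single (w : Weight) (k : ℕ) : L2 w :=
  L2.mk (Pi.single (k + 1) 1) ⟨by simp, summable_of_ne_finset_zero (s := {k}) fun j hj => by
    have : j ≠ k := by simpa using hj
    simp [this]⟩

theorem L2.seq_single (w : Weight) (k : ℕ) : seq (L2.single w k) = Pi.single (k + 1) 1 := rfl

theorem L2.inner_single_left {w : Weight} (k : ℕ) (x : L2 w) :
    inner ℝ (L2.single w k) x = x (k + 1) / w.toFun (k + 1) := by
  have h : inner ℝ (L2.single w k) x =
      ∑' j, L2.single w k (j + 1) * x (j + 1) / w.toFun (j + 1) := rfl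
  rw [h, tsum_eq_single k fun j hj => by simp [L2.seq_single, hj]]
  simp [L2.seq_single]

/-- The balance equation of the entries `(k, k + 1)` and `(k + 1, k)` of a self-adjoint `𝒦`. -/
theorem eq_of_isSelfAdjoint_calK {α β : ℝ} (hα : 0 < α) (hαβ : α < β) {L : ℕ} (hL : 1 ≤ L)
    {θ : ℝ} (hθ : 0 < θ) (h : IsSelfAdjoint (calK hα hαβ L hθ)) (k : ℕ) :
    L * (α / β) ^ L ^ (k + 1) = θ := by
  have hβ : 0 < β := hα.trans hαβ
  have h1 := (ContinuousLinearMap.isSelfAdjoint_iff_isSymmetric.1 h)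
    (L2.single (geom θ hθ) (k + 1)) (L2.single (geom θ hθ) k)
  simp only [ContinuousLinearMap.coe_coe] at h1
  rw [real_inner_comm, L2.inner_single_left, L2.inner_single_left, calK_apply, calK_apply,
    calKseq_succ hβ.ne' hL, calKseq_succ hβ.ne' hL] at h1
  simp only [L2.seq_single, geom, Pi.single_apply] at h1
  simp only [Nat.left_eq_add, Nat.add_left_cancel_iff, OfNat.ofNat_ne_one,
    if_false, if_true, mul_zero, mul_one, sub_zero, zero_add, add_zero, add_assoc,
    Nat.reduceAdd, OfNat.one_ne_ofNat, OfNat.ofNat_ne_zero] at h1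
  rw [pow_succ θ (k + 1)] at h1
  field_simp at h1
  linarith

end LinStab

/-! ### The theorem. -/

open LinStab in
theorem theorem2p8 (L : ℕ) (hL : 1 ≤ L) (α β : ℝ) (hα : 0 < α) (hαβ : α < β)
    (θ : ℝ) (hθ0 : 0 < θ) (hθ1 : θ < 1) (hθ : L = 1 → α / β ≤ θ) :
    -- `t ↦ e^{𝒦 t} z₀` is the unique solution starting at `z₀`
    (∀ (z₀ : LinStab.L2 (LinStab.geom θ hθ0)) (z : ℝ → LinStab.L2 (LinStab.geom θ hθ0)),
      (z 0 = z₀ ∧ LinStab.IsSolution (LinStab.calK hα hαβ L hθ0) z) ↔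
        ∀ t, 0 ≤ t → z t = LinStab.expOp (LinStab.calK hα hαβ L hθ0) t z₀) ∧
    -- exponential stability
    (∃ γ : ℝ, 0 < γ ∧ ∃ C : ℝ, ∀ z₀ : LinStab.L2 (LinStab.geom θ hθ0), ∀ t : ℝ, 0 ≤ t →
      ‖LinStab.expOp (LinStab.calK hα hαβ L hθ0) t z₀‖ ≤ Real.exp (-γ * t) * C * ‖z₀‖) ∧
    -- lack of self-adjointness
    (¬ (L = 1 ∧ θ = α / β) → ¬ IsSelfAdjoint (LinStab.calK hα hαβ L hθ0)) := by
  have hβ : 0 < β := hα.trans hαβ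
  have hρ0 : 0 < α / β := div_pos hα hβ
  have hρ1 : α / β < 1 := (div_lt_one hβ).2 hαβ
  refine ⟨fun z₀ z => ⟨fun h t ht => ?_, fun h => ⟨?_, fun t ht => ?_⟩⟩, ?_, fun hne hsa => ?_⟩
  · rw [← h.1]
    exact eq_exp_smul_apply_of_hasDerivWithinAt h.2 ht
  · simpa [expOp] using h 0 le_rfl
  · rw [h t ht]
    exact (hasDerivAt_exp_smul_apply _ z₀ t).hasDerivWithinAt.congr (fun s hs => h s hs) (h t ht)
  · have hb : ∀ k, 0 < (L : ℝ) * (α / β) ^ L ^ k := fun k => by positivity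
    obtain ⟨γ, hγ, g, h, hp⟩ :
        ∃ γ > 0, ∃ g h, IsSchurPair (fun k => (L : ℝ) * (α / β) ^ L ^ k) θ γ g h := by
      rcases hL.eq_or_lt with rfl | hL
      · simpa using exists_isSchurPair_of_const hρ0.le hθ0 hθ1 (hθ rfl)
      · refine exists_isSchurPair_of_tendsto_zero hb ?_ hθ0 hθ1
        simpa using ((tendsto_pow_atTop_nhds_zero_of_lt_one hρ0.le hρ1).comp
          (tendsto_pow_atTop_atTop_of_one_lt hL)).const_mul (L : ℝ)
    obtain ⟨C, hC⟩ := hp.exists_norm_exp_le hθ0 (fun k => (hb k).le) hβ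
      (T := calK hα hαβ L hθ0) fun x k => by
        rw [calK_apply, calKseq_succ hβ.ne' hL]
        ring
    exact ⟨β * γ, mul_pos hβ hγ, C, hC⟩
  · have h1 := eq_of_isSelfAdjoint_calK hα hαβ hL hθ0 hsa 0
    have h2 := eq_of_isSelfAdjoint_calK hα hαβ hL hθ0 hsa 1
    rcases hL.eq_or_lt with rfl | hL
    · exact hne ⟨rfl, by simpa using h1.symm⟩
    -- For `L ≥ 2` the balance equations for `k = 0` and `k = 1` contradict each other, as `ρ ^ L ^
    -- 2 < ρ ^ L`.
    · have hlt := pow_lt_pow_right_of_lt_one₀ hρ0 hρ1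
        (Nat.pow_lt_pow_right hL (show 0 + 1 < 1 + 1 by norm_num))
      have hL0 : (0 : ℝ) < L := by positivity
      have := mul_lt_mul_of_pos_left hlt hL0
      linarith
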